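/- An affine formula $\phi$ is a conjunction of $m$ linear equations over $\mathbb{F}_2$ in $n$ Boolean variables. In the problem Max Differ Affine-SAT, the input is an affine formula $\phi$ and a non-negative integer $d$, and the question is whether $\phi$ has two satisfying assignments that differ on at least $d$ variables (for $d=0$ the two assignments may coincide). **Theorem.** Max Differ Affine-SAT can be solved in $O^{\star}(2^d)$ time, where $O^{\star}$ hides factors polynomial in the input size. That is, there are a single random access machine program and a polynomial $p$ such that, on every instance $(\phi,d)$, with $\phi$ given by its coefficient matrix and right-hand side, the program halts after at most $2^d\cdot p(n+m)$ steps and answers YES if $\phi$ has two satisfying assignments that differ on at least $d$ variables, and NO otherwise. (The machine has registers and indirectly addressed arrays of natural numbers; its arithmetic operations are adding and subtracting $1$; every instruction and every test counts as one step.) -/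

import Mathlib

/-! ### Affine formulas and the problem -/

/-- An affine formula: a conjunction of `numEqs` linear equations over the field with two elements
in `numVars` Boolean variables. The `i`-th equation is
`∑ j, coeff i j * x j = rhs i`, with sums taken modulo 2. -/
structure AffineFormula where
  numVars : ℕ
  numEqs : ℕ
  coeff : Matrix (Fin numEqs) (Fin numVars) (ZMod 2)
  rhs : Fin numEqs → ZMod 2

namespace AffineFormula

/-- A truth assignment to all the variables of `φ`. -/
abbrev Assignment (φ : AffineFormula) : Type := Fin φ.numVars → ZMod 2

/-- The assignment `σ` satisfies every equation of `φ`. -/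
def Satisfies (φ : AffineFormula) (σ : φ.Assignment) : Prop :=
  ∀ i, ∑ j, φ.coeff i j * σ j = φ.rhs i

/-- The size of `φ`: its number of variables plus its number of equations. -/
def size (φ : AffineFormula) : ℕ := φ.numVars + φ.numEqs

/-- `(φ, d)` is a yes-instance of Max Differ Affine-SAT: there are two satisfying assignments
which differ on at least `d` variables (`hammingDist` counts the variables on which they differ). -/
def MaxDiffer (φ : AffineFormula) (d : ℕ) : Prop :=
  ∃ σ τ : φ.Assignment, φ.Satisfies σ ∧ φ.Satisfies τ ∧ d ≤ hammingDist σ τ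

end AffineFormula

/-! ### Random access machines with a step count

Programs work on registers and on arrays with indirect addressing, all holding natural numbers.
A program is a finite object, so it mentions only finitely many registers and arrays.
The only arithmetic operations are adding and subtracting one, so that after `t` steps every stored
number exceeds the largest number in the input or in the program by at most `t`, and it is
appropriate to charge one unit for every instruction and every test. -/

namespace RAM

/-- The contents of the registers and of the arrays. -/
structure State where
  reg : ℕ → ℕ
  arr : ℕ → ℕ → ℕ

namespace State

/-- Write `v` to register `x`. -/
def setReg (s : State) (x v : ℕ) : State :=
  { s with reg := Function.update s.reg x v }

/-- Write `v` to cell `k` of array `a`. -/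
def setArr (s : State) (a k v : ℕ) : State :=
  { s with arr := Function.update s.arr a (Function.update (s.arr a) k v) }

end State

/-- Basic instructions. -/
inductive Instr where
  | const (x c : ℕ)
  | copy (x y : ℕ)
  | succ (x : ℕ)
  | pred (x : ℕ)
  | load (x a y : ℕ)
  | store (a x y : ℕ)

/-- The effect of a basic instruction. -/
def Instr.apply (s : State) : Instr → State
  | .const x c => s.setReg x c
  | .copy x y => s.setReg x (s.reg y)
  | .succ x => s.setReg x (s.reg x + 1)
  | .pred x => s.setReg x (s.reg x - 1)
  | .load x a y => s.setReg x (s.arr a (s.reg y))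
  | .store a x y => s.setArr a (s.reg x) (s.reg y)

/-- Tests on the contents of registers. -/
inductive Test where
  | zero (x : ℕ)
  | eq (x y : ℕ)
  | lt (x y : ℕ)

/-- The test succeeds in the state `s`. -/
def Test.Holds (s : State) : Test → Prop
  | .zero x => s.reg x = 0
  | .eq x y => s.reg x = s.reg y
  | .lt x y => s.reg x < s.reg y

/-- Programs: instructions, sequencing, conditionals, and while-loops (`loop b P` repeats `P` as
long as the test `b` holds). -/
inductive Program where
  | skip
  | instr (i : Instr)
  | seq (P Q : Program)
  | cond (b : Test) (P Q : Program)
  | loop (b : Test) (P : Program)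

/-- `Runs P s s' t`: the program `P`, started in the state `s`, halts in the state `s'` after
exactly `t` steps. Each executed instruction and each evaluated test is one step. -/
inductive Runs : Program → State → State → ℕ → Prop where
  | skip (s : State) : Runs .skip s s 1
  | instr (i : Instr) (s : State) : Runs (.instr i) s (i.apply s) 1
  | seq {P Q : Program} {s s' s'' : State} {t t' : ℕ} :
      Runs P s s' t → Runs Q s' s'' t' → Runs (.seq P Q) s s'' (t + t')
  | cond_true {b : Test} {P Q : Program} {s s' : State} {t : ℕ} :
      b.Holds s → Runs P s s' t → Runs (.cond b P Q) s s' (t + 1)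
  | cond_false {b : Test} {P Q : Program} {s s' : State} {t : ℕ} :
      ¬ b.Holds s → Runs Q s s' t → Runs (.cond b P Q) s s' (t + 1)
  | loop_true {b : Test} {P : Program} {s s' s'' : State} {t t' : ℕ} :
      b.Holds s → Runs P s s' t → Runs (.loop b P) s' s'' t' →
        Runs (.loop b P) s s'' (t + t' + 1)
  | loop_false {b : Test} {P : Program} {s : State} :
      ¬ b.Holds s → Runs (.loop b P) s s 1

/-- The initial state on the instance `(φ, d)`. Registers 0, 1, 2 hold the number of variables, the
number of equations, and `d`. Array 0 holds the coefficients row by row (the coefficient of variable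
`j` in equation `i` is in cell `j + numVars * i`), array 1 holds the right-hand sides.
Everything else is 0. -/
def input (φ : AffineFormula) (d : ℕ) : State where
  reg
    | 0 => φ.numVars
    | 1 => φ.numEqs
    | 2 => d
    | _ => 0
  arr
    | 0 => fun k =>
        if h : k < φ.numEqs * φ.numVars then
          let ij := finProdFinEquiv.symm ⟨k, h⟩
          (φ.coeff ij.1 ij.2).val
        else 0
    | 1 => fun k => if h : k < φ.numEqs then (φ.rhs ⟨k, h⟩).val else 0
    | _ => fun _ => 0

/-- The program `P` decides the problem `yes`, where instances are pairs of an affine formula and a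
natural number, and it takes at most `T φ d` steps on the instance `(φ, d)`. When it halts, register
0 contains the answer: 1 for YES, 0 for NO. -/
def DecidesInTime (P : Program) (yes : AffineFormula → ℕ → Prop) (T : AffineFormula → ℕ → ℕ) :
    Prop :=
  ∀ (φ : AffineFormula) (d : ℕ), ∃ (s : State) (t : ℕ), Runs P (input φ d) s t ∧ t ≤ T φ d ∧
    ((yes φ d ∧ s.reg 0 = 1) ∨ (¬ yes φ d ∧ s.reg 0 = 0))

end RAM

/-! Let n be the number of variables. Homogenizing gives the right-hand side a variable of its own,
with index n. Solutions with last entry 1 are the satisfying assignments; if there is one, the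
solutions with last entry 0 are exactly the differences of two satisfying assignments. So the
question is whether the formula is consistent and whether some solution with last entry 0 has weight
at least d (`AffineFormula.maxDiffer_iff`).

Gaussian elimination, one equation at a time (`SystematicSpan.inf_ker`), yields vectors V 0, …, V n
spanning the solutions, where each nonzero V j owns coordinate j and only V n can have a nonzero
last entry. The sum of any d nonzero vectors among V 0, …, V (n - 1) has weight at least d, because
every summand keeps its own coordinate (`SystematicSpan.card_le_weight`). With fewer than d nonzero
vectors, their span has fewer than 2^d elements. In both cases it suffices to search the span of the
first nonzero vectors, at most d of them (`exists_weight_iff`). Listing that span costs 2^d times a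
polynomial; everything else is polynomial.

The machine program is verified with a Hoare-style calculus, `Ensures`, that carries a time bound.
-/

namespace RAM

/-! ### Total correctness with a time bound -/

/-- Started in the state `s`, the program `P` halts after at most `T` steps in a state that
satisfies `Q`. -/
def Ensures (P : Program) (s : State) (T : ℕ) (Q : State → Prop) : Prop :=
  ∃ s' t, Runs P s s' t ∧ t ≤ T ∧ Q s'

/-- Whether the instruction writes to the register `r`. -/
def Instr.writesReg (r : ℕ) : Instr → Bool
  | .const x _ => r == x
  | .copy x _ => r == x
  | .succ x => r == x
  | .pred x => r == x
  | .load x _ _ => r == x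
  | .store _ _ _ => false

/-- Whether the instruction writes to the array `a`. -/
def Instr.writesArr (a : ℕ) : Instr → Bool
  | .store b _ _ => a == b
  | _ => false

/-- Whether some instruction of the program writes to the register `r`. -/
def Program.writesReg (r : ℕ) : Program → Bool
  | .skip => false
  | .instr i => i.writesReg r
  | .seq P Q => P.writesReg r || Q.writesReg r
  | .cond _ P Q => P.writesReg r || Q.writesReg r
  | .loop _ P => P.writesReg r

/-- Whether some instruction of the program writes to the array `a`. -/
def Program.writesArr (a : ℕ) : Program → Bool
  | .skip => false
  | .instr i => i.writesArr a
  | .seq P Q => P.writesArr a || Q.writesArr a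
  | .cond _ P Q => P.writesArr a || Q.writesArr a
  | .loop _ P => P.writesArr a

/-- The states agree on all the registers and arrays to which `P` does not write. -/
structure Frame (P : Program) (s s' : State) : Prop where
  reg : ∀ r, P.writesReg r = false → s'.reg r = s.reg r
  arr : ∀ a, P.writesArr a = false → s'.arr a = s.arr a

theorem Frame.refl (P : Program) (s : State) : Frame P s s := ⟨fun _ _ => rfl, fun _ _ => rfl⟩

theorem Frame.trans {P : Program} {s s' s'' : State} (h : Frame P s s') (h' : Frame P s' s'') :
    Frame P s s'' :=
  ⟨fun r hr => (h'.reg r hr).trans (h.reg r hr), fun a ha => (h'.arr a ha).trans (h.arr a ha)⟩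

theorem Frame.mono {P Q : Program} {s s' : State} (h : Frame P s s')
    (hreg : ∀ r, Q.writesReg r = false → P.writesReg r = false)
    (harr : ∀ a, Q.writesArr a = false → P.writesArr a = false) : Frame Q s s' :=
  ⟨fun r hr => h.reg r (hreg r hr), fun a ha => h.arr a (harr a ha)⟩

/-- Write sets are computed syntactically, so for a concrete program the side condition that a
register or array is untouched holds by `rfl`. -/
theorem Runs.frame {P : Program} {s s' : State} {t : ℕ} (h : Runs P s s' t) : Frame P s s' := by
  induction h with
  | skip s => exact Frame.refl _ _
  | instr i s =>
    cases i <;> constructor <;> intro r hr <;>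
      simp_all [Instr.apply, Program.writesReg, Program.writesArr, Instr.writesReg,
        Instr.writesArr, State.setReg, State.setArr]
  | seq _ _ ih ih' =>
    refine (ih.mono ?_ ?_).trans (ih'.mono ?_ ?_) <;>
      simp +contextual [Program.writesReg, Program.writesArr]
  | cond_true _ _ ih =>
    refine ih.mono ?_ ?_ <;>
      simp +contextual [Program.writesReg, Program.writesArr]
  | cond_false _ _ ih =>
    refine ih.mono ?_ ?_ <;>
      simp +contextual [Program.writesReg, Program.writesArr]
  | loop_true _ _ _ ih ih' =>
    refine (ih.mono ?_ ?_).trans ih' <;>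
      simp +contextual [Program.writesReg, Program.writesArr]
  | loop_false _ => exact Frame.refl _ _

namespace Ensures

variable {P P' : Program} {s : State} {T T' : ℕ} {Q Q' : State → Prop}

/-- The frame is supplied when the postcondition is changed, so specifications need to mention only
what a program modifies. -/
theorem mono (h : Ensures P s T Q) (hT : T ≤ T') (hQ : ∀ s', Frame P s s' → Q s' → Q' s') :
    Ensures P s T' Q' := by
  obtain ⟨s', t, hr, ht, hq⟩ := h
  exact ⟨s', t, hr, ht.trans hT, hQ _ hr.frame hq⟩

theorem skip (h : Q s) : Ensures .skip s (T + 1) Q := ⟨s, 1, .skip s, by omega, h⟩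

theorem instr (i : Instr) (h : Q (i.apply s)) : Ensures (.instr i) s (T + 1) Q :=
  ⟨_, 1, .instr i s, by omega, h⟩

theorem seq (h : Ensures P s T fun s' => Frame P s s' → Ensures P' s' T' Q) :
    Ensures (.seq P P') s (T + T') Q := by
  obtain ⟨s', t, hr, ht, s'', t', hr', ht', hq⟩ := h.mono le_rfl fun s' hf h => h hf
  exact ⟨s'', _, .seq hr hr', by omega, hq⟩

theorem instr_seq (i : Instr) (h : Ensures P (i.apply s) T Q) :
    Ensures (.seq (.instr i) P) s (T + 1) Q := by
  obtain ⟨s'', t', hr', ht', hq⟩ := h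
  exact ⟨s'', _, .seq (.instr i s) hr', by omega, hq⟩

theorem cond {b : Test} (h : b.Holds s → Ensures P s T Q) (h' : ¬ b.Holds s → Ensures P' s T Q) :
    Ensures (.cond b P P') s (T + 1) Q := by
  by_cases hb : b.Holds s
  · obtain ⟨s', t, hr, ht, hq⟩ := h hb
    exact ⟨s', _, .cond_true hb hr, by omega, hq⟩
  · obtain ⟨s', t, hr, ht, hq⟩ := h' hb
    exact ⟨s', _, .cond_false hb hr, by omega, hq⟩

/-- Indexing the invariant by the number of completed rounds fixes the number of rounds in advance,
so termination needs no separate measure. Each round pays for the body and one test; the last unit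
is the failing test. -/
theorem loop {b : Test} (Inv : ℕ → State → Prop) (K T : ℕ) (h0 : Inv 0 s)
    (hstep : ∀ k < K, ∀ s', Frame P s s' → Inv k s' →
      b.Holds s' ∧ Ensures P s' T (Inv (k + 1)))
    (hend : ∀ s', Frame P s s' → Inv K s' → ¬ b.Holds s') :
    Ensures (.loop b P) s (K * (T + 1) + 1) (Inv K) := by
  -- Induction on the number `l` of remaining rounds.
  suffices H : ∀ l k, k + l = K → ∀ s', Frame P s s' → Inv k s' →
      Ensures (.loop b P) s' (l * (T + 1) + 1) (Inv K) from
    H K 0 (zero_add K) s (Frame.refl _ _) h0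
  intro l
  induction l with
  | zero =>
    rintro k rfl s' hf hi
    exact ⟨s', 1, .loop_false (hend s' hf hi), by omega, hi⟩
  | succ l ih =>
    intro k hk s' hf hi
    obtain ⟨hb, s'', t, hr, ht, hi'⟩ := hstep k (by omega) s' hf hi
    obtain ⟨s₃, t', hr', ht', hq⟩ := ih (k + 1) (by omega) s'' (hf.trans hr.frame) hi'
    refine ⟨s₃, _, .loop_true hb hr hr', ?_, hq⟩
    rw [Nat.succ_mul]
    omega

end Ensures

/-- Run `P` with the register `i` counting from `0` up to the contents of the register `b`. -/
def Program.forLoop (i b : ℕ) (P : Program) : Program :=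
  .seq (.instr (.const i 0)) (.loop (.lt i b) (.seq P (.instr (.succ i))))

/-- The invariant must not depend on the counter `i`, whose value is handed to the body separately.
The overhead is a test and an increment per round, plus the initialization and the failing test. -/
theorem Ensures.forLoop {i b : ℕ} {P : Program} {s : State} (Inv : ℕ → State → Prop) (K T : ℕ)
    (hK : s.reg b = K) (h0 : Inv 0 s)
    (hInv : ∀ k s' v, Inv k s' → Inv k (s'.setReg i v))
    (hstep : ∀ k < K, ∀ s', s'.reg i = k → Frame (.forLoop i b P) s s' → Inv k s' →
      Ensures P s' T (Inv (k + 1)))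
    (hib : i ≠ b := by decide) (hi : P.writesReg i = false := by rfl)
    (hb : P.writesReg b = false := by rfl) :
    Ensures (.forLoop i b P) s (K * (T + 2) + 2) (Inv K) := by
  have hbw : (Program.seq P (.instr (.succ i))).writesReg b = false := by
    simp [Program.writesReg, Instr.writesReg, hb, hib.symm]
  have hfr : ∀ s', Frame (.seq P (.instr (.succ i))) (s.setReg i 0) s' →
      Frame (.forLoop i b P) s s' ∧ s'.reg b = K := by
    intro s' hf
    refine ⟨⟨fun r hr => ?_, fun a ha => ?_⟩, ?_⟩
    · simp only [Program.forLoop, Program.writesReg, Instr.writesReg, Bool.or_eq_false_iff,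
        beq_eq_false_iff_ne] at hr
      rw [hf.reg r (by simp [Program.writesReg, Instr.writesReg, hr])]
      simp [State.setReg, hr.1]
    · simp only [Program.forLoop, Program.writesArr, Instr.writesArr, Bool.or_eq_false_iff] at ha
      rw [hf.arr a (by simp [Program.writesArr, Instr.writesArr, ha])]
      rfl
    · rw [hf.reg b hbw]
      simp [State.setReg, hib.symm, hK]
  refine (Ensures.instr_seq _ (Ensures.mono (Ensures.loop
    (fun k s' => s'.reg i = k ∧ Inv k s') K (T + 1) ⟨?_, ?_⟩ ?_ ?_) le_rfl
      fun s' _ h => h.2)).mono (by rw [add_assoc T 1 1, add_assoc]) fun s' _ h => h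
  · simp [Instr.apply, State.setReg]
  · exact hInv 0 s 0 h0
  · rintro k hk s' hf ⟨hik, hinv⟩
    obtain ⟨hf', hb'⟩ := hfr s' hf
    refine ⟨?_, ?_⟩
    · simpa [Test.Holds, hik, hb'] using hk
    · refine Ensures.seq ((hstep k hk s' hik hf' hinv).mono le_rfl fun s₂ hf₂ h₂ _ => ?_)
      refine Ensures.instr (T := 0) _ ⟨?_, hInv _ _ _ h₂⟩
      simp [Instr.apply, State.setReg, hf₂.reg i hi, hik]
  · rintro s' hf ⟨hik, -⟩
    simp [Test.Holds, hik, (hfr s' hf).2]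

end RAM

/-! ### Systematic spanning sets over the field with two elements -/

open Finset in
/-- The linear functional with coefficients `a`, on the first `N` coordinates. -/
def rowFunctional (N : ℕ) (a : ℕ → ZMod 2) : (ℕ → ZMod 2) →ₗ[ZMod 2] ZMod 2 :=
  ∑ c ∈ range N, a c • LinearMap.proj c

theorem rowFunctional_apply (N : ℕ) (a x : ℕ → ZMod 2) :
    rowFunctional N a x = ∑ c ∈ Finset.range N, a c * x c := by
  simp [rowFunctional]

/-- The vectors of length `N` that are annihilated by the first `k` rows of `a`. -/
def solutions (N : ℕ) (a : ℕ → ℕ → ZMod 2) : ℕ → Submodule (ZMod 2) (ℕ → ZMod 2)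
  | 0 => ⨅ c ∈ Set.Ici N, LinearMap.ker (LinearMap.proj c)
  | k + 1 => solutions N a k ⊓ LinearMap.ker (rowFunctional N (a k))

theorem mem_solutions {N : ℕ} {a : ℕ → ℕ → ZMod 2} {k : ℕ} {x : ℕ → ZMod 2} :
    x ∈ solutions N a k ↔ (∀ c, N ≤ c → x c = 0) ∧
      ∀ i < k, ∑ c ∈ Finset.range N, a i c * x c = 0 := by
  induction k with
  | zero => simp [solutions, Submodule.mem_iInf]
  | succ k ih =>
    simp only [solutions, Submodule.mem_inf, ih, LinearMap.mem_ker, rowFunctional_apply,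
      Nat.lt_succ_iff_lt_or_eq]
    constructor
    · rintro ⟨⟨h, h'⟩, h''⟩
      exact ⟨h, by rintro i (hi | rfl); exacts [h' i hi, h'']⟩
    · rintro ⟨h, h'⟩
      exact ⟨⟨h, fun i hi => h' i (.inl hi)⟩, h' k (.inr rfl)⟩

/-- The vectors `V 0, …, V n` span the subspace `S`; each of them is zero or has a coordinate of
its own, and only the last one may be nonzero in the last coordinate. -/
structure SystematicSpan (n : ℕ) (S : Submodule (ZMod 2) (ℕ → ZMod 2)) (V : ℕ → ℕ → ZMod 2) :
    Prop where
  mem : ∀ j < n + 1, V j ∈ S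
  eq_sum : ∀ x ∈ S, x = ∑ j ∈ Finset.range (n + 1), x j • V j
  eq_zero : ∀ j < n + 1, V j j = 0 → V j = 0
  off_diag : ∀ j < n + 1, ∀ c < n + 1, V c c ≠ 0 → j ≠ c → V j c = 0
  last : ∀ j < n, V j n = 0

theorem systematicSpan_one (n : ℕ) (a : ℕ → ℕ → ZMod 2) :
    SystematicSpan n (solutions (n + 1) a 0) fun j c => if j = c then 1 else 0 where
  mem j hj := by
    rw [mem_solutions]
    exact ⟨fun c hc => if_neg (by omega), by simp⟩
  eq_sum x hx := by
    rw [mem_solutions] at hx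
    ext c
    simp only [Finset.sum_apply, Pi.smul_apply, smul_eq_mul, mul_ite, mul_one, mul_zero,
      Finset.sum_ite_eq', Finset.mem_range]
    split_ifs with h
    · rfl
    · exact hx.1 c (by omega)
  eq_zero := by simp
  off_diag := by simp
  last j hj := if_neg (by omega)

theorem ZMod.two_eq_zero_or_one (x : ZMod 2) : x = 0 ∨ x = 1 := by revert x; decide

/-- Passing to the kernel of a functional `f` that vanishes on all the vectors. -/
theorem SystematicSpan.inf_ker_of_forall {n : ℕ} {S : Submodule (ZMod 2) (ℕ → ZMod 2)}
    {V : ℕ → ℕ → ZMod 2} (h : SystematicSpan n S V) (f : (ℕ → ZMod 2) →ₗ[ZMod 2] ZMod 2)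
    (hf : ∀ j < n + 1, f (V j) = 0) : SystematicSpan n (S ⊓ LinearMap.ker f) V where
  mem j hj := ⟨h.mem j hj, hf j hj⟩
  eq_sum x hx := h.eq_sum x hx.1
  eq_zero := h.eq_zero
  off_diag := h.off_diag
  last := h.last

/-- Passing to the kernel of a functional `f`, where `V p` is the first vector outside. -/
theorem SystematicSpan.inf_ker {n : ℕ} {S : Submodule (ZMod 2) (ℕ → ZMod 2)}
    {V V' : ℕ → ℕ → ZMod 2} (h : SystematicSpan n S V) (f : (ℕ → ZMod 2) →ₗ[ZMod 2] ZMod 2)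
    {p : ℕ} (hp : p < n + 1) (hfp : f (V p) = 1) (hlt : ∀ j < p, f (V j) = 0)
    (hV' : ∀ j < n + 1, V' j = V j + f (V j) • V p) :
    SystematicSpan n (S ⊓ LinearMap.ker f) V' := by
  have hpp : V p p ≠ 0 := fun h0 => by simp [h.eq_zero p hp h0] at hfp
  have hdead : V' p = 0 := by
    rw [hV' p hp, hfp, one_smul, CharTwo.add_self_eq_zero]
  have hzero : ∀ j < n + 1, V j j = 0 → V' j = 0 := fun j hj h0 => by
    rw [hV' j hj, h.eq_zero j hj h0]
    simp
  -- Adding `V p` leaves the coordinates owned by the other vectors unchanged.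
  have hdiag : ∀ j < n + 1, j ≠ p → V' j j = V j j := fun j hj hjp => by
    by_cases h0 : V j j = 0
    · rw [hzero j hj h0, h0, Pi.zero_apply]
    · simp [hV' j hj, h.off_diag p hp j hj h0 hjp.symm]
  refine ⟨fun j hj => ⟨?_, ?_⟩, fun x hx => ?_, fun j hj h0 => ?_, fun j hj c hc h0 hjc => ?_,
    fun j hj => ?_⟩
  · rw [hV' j hj]
    exact S.add_mem (h.mem j hj) (S.smul_mem _ (h.mem p hp))
  · simp only [SetLike.mem_coe, LinearMap.mem_ker]
    rw [hV' j hj, map_add, map_smul, hfp, smul_eq_mul, mul_one, CharTwo.add_self_eq_zero]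
  -- This sum is `f x`. It is also the total coefficient of the added copies of `V p`, so the
  -- expansion of `x` survives.
  · have hfx : ∑ j ∈ Finset.range (n + 1), x j * f (V j) = 0 := by
      have := LinearMap.mem_ker.1 hx.2
      rw [h.eq_sum x hx.1] at this
      simpa using this
    calc x = ∑ j ∈ Finset.range (n + 1), x j • V j + (0 : ZMod 2) • V p := by
          rw [zero_smul, add_zero]; exact h.eq_sum x hx.1
      _ = ∑ j ∈ Finset.range (n + 1), x j • V' j := by
          rw [← hfx, Finset.sum_smul, ← Finset.sum_add_distrib]
          refine Finset.sum_congr rfl fun j hj => ?_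
          rw [hV' j (Finset.mem_range.1 hj), smul_add, smul_smul]
  · by_cases hjp : j = p
    · rw [hjp, hdead]
    · exact hzero j hj ((hdiag j hj hjp).symm.trans h0)
  · have hcp : c ≠ p := by
      rintro rfl
      simp [hdead] at h0
    rw [hdiag c hc hcp] at h0
    simp [hV' j hj, h.off_diag j hj c hc h0 hjc, h.off_diag p hp c hc h0 hcp.symm]
  · rw [hV' j (by omega)]
    -- Here it matters that `p` is the first pivot candidate: `V p` has last entry 0 unless `p = n`,
    -- and then no earlier vector is changed.
    rcases Nat.lt_succ_iff_lt_or_eq.1 hp with hpn | rfl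
    · simp [h.last j hj, h.last p hpn]
    · simp [h.last j hj, hlt j hj]

/-- The number of nonzero entries among the first `N` ones. -/
def weight (N : ℕ) (x : ℕ → ZMod 2) : ℕ := ((Finset.range N).filter fun c => x c ≠ 0).card

theorem SystematicSpan.card_le_weight {n : ℕ} {S : Submodule (ZMod 2) (ℕ → ZMod 2)}
    {V : ℕ → ℕ → ZMod 2} (h : SystematicSpan n S V) (I : Finset ℕ)
    (hI : ∀ j ∈ I, j < n ∧ V j j ≠ 0) : I.card ≤ weight (n + 1) (∑ j ∈ I, V j) := by
  refine Finset.card_le_card fun c hc => ?_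
  obtain ⟨hcn, h0⟩ := hI c hc
  rw [Finset.mem_filter, Finset.mem_range, Finset.sum_apply, Finset.sum_eq_single_of_mem c hc]
  · exact ⟨by omega, h0⟩
  · intro j hj hjc
    exact h.off_diag j (by have := (hI j hj).1; omega) c (by omega) h0 hjc

/-! ### The homogenized system -/

namespace AffineFormula

/-- The equations of `φ`, as rows of length `numVars + 1` that end with the right-hand side. -/
def row (φ : AffineFormula) (i c : ℕ) : ZMod 2 :=
  if h : i < φ.numEqs then
    if h' : c < φ.numVars then φ.coeff ⟨i, h⟩ ⟨c, h'⟩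
    else if c = φ.numVars then φ.rhs ⟨i, h⟩ else 0
  else 0

/-- The vector that consists of `x` and the last entry `z`. -/
def extend (φ : AffineFormula) (x : φ.Assignment) (z : ZMod 2) (c : ℕ) : ZMod 2 :=
  if h : c < φ.numVars then x ⟨c, h⟩ else if c = φ.numVars then z else 0

/-- The solution space of the homogenized system. -/
abbrev homSolutions (φ : AffineFormula) : Submodule (ZMod 2) (ℕ → ZMod 2) :=
  solutions (φ.numVars + 1) φ.row φ.numEqs

theorem mem_homSolutions (φ : AffineFormula) {x : ℕ → ZMod 2} :
    x ∈ φ.homSolutions ↔ (∀ c, φ.numVars < c → x c = 0) ∧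
      ∀ i, ∑ j, φ.coeff i j * x j = φ.rhs i * x φ.numVars := by
  have key : ∀ i : Fin φ.numEqs, ∑ c ∈ Finset.range (φ.numVars + 1), φ.row i c * x c =
      ∑ j, φ.coeff i j * x j + φ.rhs i * x φ.numVars := by
    intro i
    rw [Finset.sum_range_succ, Finset.sum_range]
    simp [row]
  rw [mem_solutions]
  refine and_congr Iff.rfl ⟨fun h i => ?_, fun h i hi => ?_⟩
  · rw [← CharTwo.add_eq_zero, ← key]
    exact h i i.2
  · rw [key ⟨i, hi⟩, CharTwo.add_eq_zero]
    exact h ⟨i, hi⟩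

theorem extend_mem_homSolutions (φ : AffineFormula) {x : φ.Assignment} {z : ZMod 2} :
    φ.extend x z ∈ φ.homSolutions ↔ ∀ i, ∑ j, φ.coeff i j * x j = φ.rhs i * z := by
  rw [mem_homSolutions]
  simp only [extend, Fin.is_lt, dite_true, Fin.eta, lt_irrefl, dite_false, if_true]
  refine and_iff_right fun c hc => ?_
  rw [dif_neg (by omega), if_neg (by omega)]

theorem weight_eq_hammingDist (φ : AffineFormula) {x : ℕ → ZMod 2} {σ τ : φ.Assignment}
    (h0 : x φ.numVars = 0) (h : ∀ j : Fin φ.numVars, x j = σ j + τ j) :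
    weight (φ.numVars + 1) x = hammingDist σ τ := by
  rw [weight, Finset.range_add_one, Finset.filter_insert, if_neg (by simp [h0]), hammingDist]
  symm
  refine Finset.card_bij (fun j _ => (j : ℕ)) (fun j hj => ?_) (fun i _ j _ => Fin.ext) ?_
  · simpa [h, CharTwo.add_eq_zero] using hj
  · intro c hc
    rw [Finset.mem_filter, Finset.mem_range] at hc
    refine ⟨⟨c, hc.1⟩, ?_, rfl⟩
    simpa [h ⟨c, hc.1⟩, CharTwo.add_eq_zero] using hc.2

/-- The diagonal entry of the last vector records consistency, and the other vectors span the
solutions with last entry 0, that is, the possible differences. -/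
theorem maxDiffer_iff (φ : AffineFormula) (d : ℕ) {V : ℕ → ℕ → ZMod 2}
    (hV : SystematicSpan φ.numVars φ.homSolutions V) :
    φ.MaxDiffer d ↔ V φ.numVars φ.numVars ≠ 0 ∧
      ∃ x ∈ Submodule.span (ZMod 2) (V '' Set.Iio φ.numVars), d ≤ weight (φ.numVars + 1) x := by
  set n := φ.numVars
  constructor
  · rintro ⟨σ, τ, hσ, hτ, hd⟩
    refine ⟨fun h0 => ?_, φ.extend (σ + τ) 0, ?_, ?_⟩
    -- If `V n n` were 0, all the spanning vectors would vanish in the last coordinate, but this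
    -- solution does not.
    · have hmem : φ.extend σ 1 ∈ φ.homSolutions := by
        rw [extend_mem_homSolutions]
        simpa [Satisfies] using hσ
      have := congrFun (hV.eq_sum _ hmem) n
      rw [Finset.sum_apply, Finset.sum_eq_zero] at this
      · simp [extend, n] at this
      · intro j hj
        rcases Nat.lt_succ_iff_lt_or_eq.1 (Finset.mem_range.1 hj) with hjn | rfl
        · simp [hV.last j hjn]
        · simp [h0]
    · have hmem : φ.extend (σ + τ) 0 ∈ φ.homSolutions := by
        rw [extend_mem_homSolutions]
        intro i
        simp only [Pi.add_apply, mul_add, Finset.sum_add_distrib]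
        rw [hσ i, hτ i, CharTwo.add_self_eq_zero, mul_zero]
      -- The coefficient of `V n` is the last entry of the vector, which is 0.
      rw [hV.eq_sum _ hmem, Finset.sum_range_succ]
      refine Submodule.add_mem _ (Submodule.sum_mem _ fun j hj => Submodule.smul_mem _ _
        (Submodule.subset_span ⟨j, by simpa using hj, rfl⟩)) ?_
      simp [extend, n]
    · rwa [φ.weight_eq_hammingDist (σ := σ) (τ := τ)]
      · simp [extend]
      · simp [extend]
  · rintro ⟨h1, x, hx, hd⟩
    have h1 := (ZMod.two_eq_zero_or_one _).resolve_left h1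
    have hsat := (φ.mem_homSolutions.1 (hV.mem n (by omega))).2
    have hx' : x ∈ φ.homSolutions ⊓ LinearMap.ker (LinearMap.proj n) := by
      refine (Submodule.span_le.2 ?_) hx
      rintro _ ⟨j, hj, rfl⟩
      exact ⟨hV.mem j (Nat.lt_succ_of_lt hj), hV.last j hj⟩
    have hxs := (φ.mem_homSolutions.1 hx'.1).2
    have hxn : x n = 0 := hx'.2
    -- `V n` has last entry 1, hence is itself a satisfying assignment; translating it by `x` gives
    -- the second one.
    refine ⟨fun j => V n j, fun j => V n j + x j, fun i => ?_, fun i => ?_, ?_⟩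
    · rw [hsat i, h1, mul_one]
    · simp only [mul_add, Finset.sum_add_distrib]
      rw [hsat i, hxs i, h1, hxn, mul_one, mul_zero, add_zero]
    · rwa [← φ.weight_eq_hammingDist hxn]
      intro j
      rw [← add_assoc, CharTwo.add_self_eq_zero, zero_add]

end AffineFormula

/-! ### The program -/

namespace RAM

infixr:60 " ;; " => Program.seq

namespace Program

/-- Registers: 0, 1, 2 input; 3 row length `numVars + 1`; 4, 5, 6 counters for equations, rows,
columns; 7 position in array 0; 8 position in array 2; 9 write position; 10, 11 scratch bits; 12
inner product or weight; 13 pivot flag; 14 and 15 read position and end of the list in array 4; 16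
number of rows that may still be selected; 17 verdict. Arrays: 2 spanning vectors; 3 saved pivot; 4
listed combinations; 5 current row. Positions advance cell by cell, since the machine cannot
multiply. -/
abbrev const (x c : ℕ) : Program := .instr (.const x c)
abbrev copy (x y : ℕ) : Program := .instr (.copy x y)
abbrev succ (x : ℕ) : Program := .instr (.succ x)
abbrev pred (x : ℕ) : Program := .instr (.pred x)
abbrev load (x a y : ℕ) : Program := .instr (.load x a y)
abbrev store (a x y : ℕ) : Program := .instr (.store a x y)

/-- Write the sum modulo 2 of the bits in the registers `x` and `y` to the register `z`. -/
def xorInto (z x y : ℕ) : Program := .cond (.eq x y) (.const z 0) (.const z 1)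

/-- Copy a row from the array `a`, starting at the position in the register `p`, to array 5.
The register `b` contains the length of the row. -/
def copyRow (a p b : ℕ) : Program :=
  .forLoop 6 b (.load 10 a p ;; .store 5 6 10 ;; .succ p)

/-- Compute in register 12 the inner product of the row in array 5 and the row at position
register 8 of array 2. -/
def dotRow : Program :=
  .const 12 0 ;; .forLoop 6 3 (.load 10 5 6 ;; .load 11 2 8 ;; .succ 8 ;;
    .cond (.zero 10) .skip (xorInto 12 12 11))

/-- Add the row in array 3 to the row at position register 9 of array 2; if the flag in register
13 is 0, the latter row is saved to array 3 first. -/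
def addSaved : Program :=
  .forLoop 6 3 (.load 10 2 9 ;; .cond (.zero 13) (.store 3 6 10) .skip ;; .load 11 3 6 ;;
    xorInto 10 10 11 ;; .store 2 9 10 ;; .succ 9)

/-- Intersect the space spanned by the rows in array 2 with the kernel of the row in array 5. -/
def pivotStep : Program :=
  .const 8 0 ;; .const 9 0 ;; .const 13 0 ;;
    .forLoop 5 3 (dotRow ;; .cond (.zero 12) (.copy 9 8) (addSaved ;; .const 13 1))

/-- Append to the list of rows in array 4 the sums of these rows and the row in array 5. -/
def appendSums : Program :=
  .copy 9 15 ;; .const 14 0 ;;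
    .loop (.lt 14 15) (.forLoop 6 3 (.load 10 4 14 ;; .load 11 5 6 ;; xorInto 10 10 11 ;;
      .store 4 9 10 ;; .succ 14 ;; .succ 9)) ;;
    .copy 15 9

/-- List in array 4 the linear combinations of the first `d` nonzero rows of array 2. -/
def enumerate : Program :=
  .copy 15 3 ;; .copy 16 2 ;; .const 8 0 ;;
    .forLoop 5 0 (copyRow 2 8 3 ;; .load 10 5 5 ;;
      .cond (.zero 10) .skip (.cond (.zero 16) .skip (.pred 16 ;; appendSums)))

/-- Decide in register 17 whether array 4 contains a row of weight at least `d`. -/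
def scan : Program :=
  .const 17 0 ;; .const 14 0 ;;
    .loop (.lt 14 15) (.const 12 0 ;;
      .forLoop 6 3 (.load 10 4 14 ;; .succ 14 ;; .cond (.zero 10) .skip (.succ 12)) ;;
      .cond (.lt 12 2) .skip (.const 17 1))

/-- Write the identity matrix to array 2. -/
def identity : Program :=
  .const 8 0 ;; .forLoop 5 3 (.forLoop 6 3 (.const 10 0 ;; .cond (.eq 5 6) (.const 10 1) .skip ;;
    .store 2 8 10 ;; .succ 8))

/-- Compute in array 2 a spanning set of the solutions of the homogenized system. -/
def eliminate : Program :=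
  .const 7 0 ;; .forLoop 4 1 (copyRow 0 7 0 ;; .load 10 1 4 ;; .store 5 0 10 ;; pivotStep)

/-- The program for Max Differ Affine-SAT. -/
def maxDiffer : Program :=
  .copy 3 0 ;; .succ 3 ;; identity ;; eliminate ;; enumerate ;; copyRow 2 8 3 ;; .load 10 5 0 ;;
    .cond (.zero 10) (.const 0 0) (scan ;; .copy 0 17)

end Program

/-! ### Correctness and cost of the elimination -/

open Program

/-- The array `f` contains the vectors `V 0, …, V (M - 1)` of length `N` one after the other. -/
def RowsAt (f : ℕ → ℕ) (M N : ℕ) (V : ℕ → ℕ → ZMod 2) : Prop :=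
  ∀ j < M, ∀ c < N, f (j * N + c) = (V j c).val

theorem RowsAt.congr {f : ℕ → ℕ} {M N : ℕ} {V V' : ℕ → ℕ → ZMod 2} (h : RowsAt f M N V)
    (hV : ∀ j < M, V j = V' j) : RowsAt f M N V' :=
  fun j hj c hc => by rw [h j hj c hc, hV j hj]

theorem add_mul_lt_mul {j M N c : ℕ} (hj : j < M) (hc : c < N) : j * N + c < M * N := by
  have := Nat.mul_le_mul_right N (Nat.succ_le_of_lt hj)
  rw [Nat.succ_mul] at this
  omega

theorem RowsAt.append {f f' : ℕ → ℕ} {M N : ℕ} {V : ℕ → ℕ → ZMod 2} (h : RowsAt f M N V)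
    (hf : ∀ l < M * N, f' l = f l) (hV : ∀ c < N, f' (M * N + c) = (V M c).val) :
    RowsAt f' (M + 1) N V := by
  intro j hj c hc
  rcases Nat.lt_succ_iff_lt_or_eq.1 hj with hj | rfl
  · rw [hf _ (add_mul_lt_mul hj hc), h j hj c hc]
  · exact hV c hc

theorem RowsAt.update {f f' : ℕ → ℕ} {M N j : ℕ} {V V' : ℕ → ℕ → ZMod 2} (h : RowsAt f M N V)
    (hf : ∀ l, l < j * N ∨ j * N + N ≤ l → f' l = f l)
    (hV : ∀ c < N, f' (j * N + c) = (V' j c).val) (hne : ∀ k < M, k ≠ j → V' k = V k) :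
    RowsAt f' M N V' := by
  intro k hk c hc
  by_cases hkj : k = j
  · subst hkj
    exact hV c hc
  · rw [hne k hk hkj, ← h k hk c hc]
    apply hf
    rcases Nat.lt_or_gt_of_ne hkj with h' | h'
    · exact .inl (add_mul_lt_mul h' hc)
    · right
      have := Nat.mul_le_mul_right N (Nat.succ_le_of_lt h')
      rw [Nat.succ_mul] at this
      omega

theorem val_add_eq_ite (u v : ZMod 2) : (u + v).val = if u.val = v.val then 0 else 1 := by
  revert u v; decide

theorem xorInto_ensures {z x y T : ℕ} {s : State} {Q : State → Prop} (u v : ZMod 2)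
    (hx : s.reg x = u.val) (hy : s.reg y = v.val) (h : Q (s.setReg z (u + v).val)) :
    Ensures (xorInto z x y) s (T + 2) Q := by
  rw [val_add_eq_ite] at h
  refine Ensures.cond (T := T + 1) (fun hb => ?_) (fun hb => ?_) <;>
    refine Ensures.instr _ ?_ <;>
    simp only [Test.Holds, hx, hy] at hb
  · rwa [if_pos hb] at h
  · rwa [if_neg hb] at h

theorem copyRow_ensures {a p b : ℕ} {s : State} (K : ℕ) (hK : s.reg b = K)
    (ha : a ≠ 5 := by decide) (hp : p ≠ 6 := by decide) (hp' : p ≠ 10 := by decide)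
    (hb : b ≠ 6 := by decide) (hb' : b ≠ 10 := by decide) (hbp : b ≠ p := by decide) :
    Ensures (copyRow a p b) s (K * 5 + 2) fun s' => s'.reg p = s.reg p + K ∧
      ∀ c < K, s'.arr 5 c = s.arr a (s.reg p + c) := by
  refine (Ensures.forLoop (fun k s' => s'.reg p = s.reg p + k ∧
    ∀ c < k, s'.arr 5 c = s.arr a (s.reg p + c)) K 3 hK ?_ ?_ ?_ hb.symm ?_ ?_)
  · simp
  · simp [State.setReg, hp]
  · rintro k hk s' hik hf ⟨h1, h2⟩
    have harr : s'.arr a = s.arr a := hf.arr a (by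
      simp [forLoop, writesArr, Instr.writesArr, ha])
    refine .instr_seq _ (.instr_seq _ (.instr _ ?_))
    simp only [Instr.apply, State.setReg, State.setArr]
    simp [hp', hik, h1, harr, Function.update_apply]
    refine ⟨by omega, fun c hc => ?_⟩
    split_ifs with hck
    · rw [hck]
    · exact h2 c (by omega)
  · simp [writesReg, Instr.writesReg, hp.symm]
  · simp [writesReg, Instr.writesReg, hb', hbp]

theorem dotRow_ensures {s : State} {N q : ℕ} {a v : ℕ → ZMod 2} (hN : s.reg 3 = N)
    (hq : s.reg 8 = q) (ha : ∀ c < N, s.arr 5 c = (a c).val)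
    (hv : ∀ c < N, s.arr 2 (q + c) = (v c).val) :
    Ensures dotRow s (N * 8 + 3) fun s' => s'.reg 8 = q + N ∧
      s'.reg 12 = (rowFunctional N a v).val := by
  rw [rowFunctional_apply]
  refine .instr_seq _ (Ensures.forLoop (fun k s' => s'.reg 8 = q + k ∧
    s'.reg 12 = (∑ c ∈ Finset.range k, a c * v c).val) N 6 hN ?_ ?_ ?_)
  · simp [Instr.apply, State.setReg, hq]
  · intro k s' v h
    simpa [State.setReg] using h
  · rintro k hk s' hik hf ⟨h1, h2⟩
    have h5 : s'.arr 5 = s.arr 5 := hf.arr 5 rfl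
    have h6 : s'.arr 2 = s.arr 2 := hf.arr 2 rfl
    refine .instr_seq _ (.instr_seq _ (.instr_seq _ (.cond (fun hb => ?_) fun hb => ?_)))
    · refine .skip ?_
      simp [Test.Holds, Instr.apply, State.setReg, h5, hik, ha k hk] at hb
      simp [Instr.apply, State.setReg, h1, h2, Finset.sum_range_succ, hb, add_assoc]
    · simp [Test.Holds, Instr.apply, State.setReg, h5, hik, ha k hk] at hb
      have hb := (ZMod.two_eq_zero_or_one _).resolve_left hb
      refine xorInto_ensures (∑ c ∈ Finset.range k, a c * v c) (v k) ?_ ?_ ?_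
      · simp [Instr.apply, State.setReg, h2]
      · simp [Instr.apply, State.setReg, h6, h1, hv k hk]
      · simp [Instr.apply, State.setReg, h1, Finset.sum_range_succ, hb, add_assoc]

/-- Here `u` is the pivot vector. With flag 0 the current row is itself the pivot; adding it to
itself erases it, so each cell is saved beforehand for use on later rows. -/
theorem addSaved_ensures {s : State} {N q : ℕ} {v u : ℕ → ZMod 2} (hN : s.reg 3 = N)
    (hq : s.reg 9 = q) (hv : ∀ c < N, s.arr 2 (q + c) = (v c).val)
    (hu : s.reg 13 = 0 ∧ u = v ∨ s.reg 13 ≠ 0 ∧ ∀ c < N, s.arr 3 c = (u c).val) :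
    Ensures addSaved s (N * 10 + 2) fun s' => s'.reg 9 = q + N ∧
      (∀ c < N, s'.arr 3 c = (u c).val) ∧ (∀ c < N, s'.arr 2 (q + c) = (v c + u c).val) ∧
      ∀ l, l < q ∨ q + N ≤ l → s'.arr 2 l = s.arr 2 l := by
  refine (Ensures.forLoop (fun k s' => s'.reg 9 = q + k ∧
    (∀ c < k, s'.arr 3 c = (u c).val) ∧ (∀ c < k, s'.arr 2 (q + c) = (v c + u c).val) ∧
      (∀ l, l < q ∨ q + k ≤ l → s'.arr 2 l = s.arr 2 l) ∧
      ∀ c, k ≤ c → s'.arr 3 c = s.arr 3 c) N 8 hN ?_ ?_ ?_).mono le_rfl ?_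
  · simp [hq]
  · exact fun _ _ _ h => h
  · rintro k hk s' hik hf ⟨h1, h2, h3, h4, h5⟩
    have h13 : s'.reg 13 = s.reg 13 := hf.reg 13 rfl
    have hvk : s'.arr 2 (q + k) = (v k).val := by rw [h4 _ (by omega), hv k hk]
    -- After the conditional save both cases agree: cell `k` of array 3 holds the pivot's entry.
    refine .instr_seq _ (.seq (T := 2) (T' := 5) (.mono (T := 2) (Q := fun s₂ =>
      (∀ c, s₂.arr 3 c = if c = k then (u k).val else s'.arr 3 c)) ?_ le_rfl
        fun s₂ hf₂ hs₂ _ => ?_))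
    · rcases hu with ⟨h0, rfl⟩ | ⟨h0, hu⟩
      · refine .cond (fun _ => .instr _ ?_) fun hb => (hb ?_).elim
        · simp [Instr.apply, State.setReg, State.setArr, hik, h1, hvk, Function.update_apply]
        · simp [Test.Holds, Instr.apply, State.setReg, h13, h0]
      · refine .cond (fun hb => ?_) fun hb => .skip fun c => ?_
        · simp [Test.Holds, Instr.apply, State.setReg, h13, h0] at hb
        · split_ifs with hc
          · rw [hc, ← hu k hk, ← h5 k le_rfl]
            rfl
          · rfl
    · have e9 : s₂.reg 9 = q + k := (hf₂.reg 9 rfl).trans h1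
      have e6 : s₂.reg 6 = k := (hf₂.reg 6 rfl).trans hik
      have e10 : s₂.reg 10 = (v k).val := (hf₂.reg 10 rfl).trans (by
        simp [Instr.apply, State.setReg, h1, hvk])
      have e2 : s₂.arr 2 = s'.arr 2 := hf₂.arr 2 rfl
      refine .instr_seq _ (.seq (T := 2) (T' := 2) (xorInto_ensures (v k) (u k) ?_ ?_ fun _ =>
        .instr_seq _ (.instr _ ⟨?_, ?_, ?_, ?_, ?_⟩)))
      · simp [Instr.apply, State.setReg, e10]
      · simp [Instr.apply, State.setReg, e6, hs₂]
      · simp [Instr.apply, State.setReg, State.setArr, e9, add_assoc]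
      · intro c hc
        simp only [Instr.apply, State.setReg, State.setArr]
        simp [hs₂]
        split_ifs with hck
        · rw [hck]
        · exact h2 c (by omega)
      · intro c hc
        simp only [Instr.apply, State.setReg, State.setArr]
        simp [e9, e2, Function.update_apply]
        split_ifs with hck
        · rw [hck]
        · exact h3 c (by omega)
      · intro l hl
        simp only [Instr.apply, State.setReg, State.setArr]
        simp [e9, e2, Function.update_apply]
        rw [if_neg (by omega)]
        exact h4 l (by omega)
      · intro c hc
        simp only [Instr.apply, State.setReg, State.setArr]
        simp [hs₂]
        rw [if_neg (by omega)]
        exact h5 c (by omega)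
  · rintro s' - ⟨h1, h2, h3, h4, -⟩
    exact ⟨h1, h2, h3, h4⟩

/-- A single pass both finds the pivot and reduces by it: rows before the first one outside the
kernel need no change. Until a pivot is found, the `u` of the invariant is arbitrary, as its
coefficients are all 0. -/
theorem pivotStep_ensures {s : State} {n : ℕ} {a : ℕ → ZMod 2} {V : ℕ → ℕ → ZMod 2}
    {S : Submodule (ZMod 2) (ℕ → ZMod 2)} (hN : s.reg 3 = n + 1)
    (ha : ∀ c < n + 1, s.arr 5 c = (a c).val) (hV : RowsAt (s.arr 2) (n + 1) (n + 1) V)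
    (hS : SystematicSpan n S V) :
    Ensures pivotStep s ((n + 1) * ((n + 1) * 18 + 9) + 5) fun s' =>
      ∃ V', RowsAt (s'.arr 2) (n + 1) (n + 1) V' ∧
        SystematicSpan n (S ⊓ LinearMap.ker (rowFunctional (n + 1) a)) V' := by
  set f := rowFunctional (n + 1) a with hf
  refine .instr_seq _ (.instr_seq _ (.instr_seq _ (Ensures.mono (Ensures.forLoop (fun j s' =>
    s'.reg 8 = j * (n + 1) ∧ s'.reg 9 = j * (n + 1) ∧ ∃ u : ℕ → ZMod 2,
      RowsAt (s'.arr 2) (n + 1) (n + 1) (fun k => if k < j then V k + f (V k) • u else V k) ∧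
      (s'.reg 13 = 0 ∧ (∀ k < j, f (V k) = 0) ∨
        s'.reg 13 ≠ 0 ∧ (∀ c < n + 1, s'.arr 3 c = (u c).val) ∧
          ∃ p < j, f (V p) = 1 ∧ (∀ k < p, f (V k) = 0) ∧ u = V p))
    (n + 1) (((n + 1) * 8 + 3) + (((n + 1) * 10 + 2 + 1) + 1)) hN ?_ ?_ ?_) ?_ ?_)))
  · refine ⟨?_, ?_, 0, ?_, .inl ⟨?_, ?_⟩⟩
    · simp [Instr.apply, State.setReg]
    · simp [Instr.apply, State.setReg]
    · simpa [Instr.apply, State.setReg] using hV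
    · simp [Instr.apply, State.setReg]
    · simp
  · exact fun _ _ _ h => h
  · rintro j hj s₁ hi hfr ⟨h8, h9, u, hR, hu⟩
    have h3 : s₁.reg 3 = n + 1 := (hfr.reg 3 rfl).trans hN
    have h5 : s₁.arr 5 = s.arr 5 := hfr.arr 5 rfl
    have hVj : ∀ c < n + 1, s₁.arr 2 (j * (n + 1) + c) = (V j c).val := fun c hc => by
      simpa using hR j hj c hc
    refine .seq ((dotRow_ensures h3 h8 (a := a) (by rwa [h5]) hVj).mono le_rfl ?_)
    rintro s₂ - ⟨h8', h12⟩ hfr₂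
    rw [← hf] at h12
    have e2 : s₂.arr 2 = s₁.arr 2 := hfr₂.arr 2 rfl
    have e3 : s₂.arr 3 = s₁.arr 3 := hfr₂.arr 3 rfl
    have e13 : s₂.reg 13 = s₁.reg 13 := hfr₂.reg 13 rfl
    have e9 : s₂.reg 9 = j * (n + 1) := (hfr₂.reg 9 rfl).trans h9
    refine .cond (fun hb => .instr _ ⟨?_, ?_, u, ?_, ?_⟩) fun hb => ?_
    · simp [Instr.apply, State.setReg, h8', Nat.succ_mul]
    · simp [Instr.apply, State.setReg, h8', Nat.succ_mul]
    · have h0 : f (V j) = 0 := by simpa [Test.Holds, h12] using hb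
      simp only [Instr.apply, State.setReg, e2]
      refine hR.congr fun k hk => ?_
      rcases lt_trichotomy k j with h | rfl | h
      · rw [if_pos h, if_pos (by omega)]
      · simp [h0]
      · rw [if_neg (by omega), if_neg (by omega)]
    · have h0 : f (V j) = 0 := by simpa [Test.Holds, h12] using hb
      refine hu.imp ?_ ?_
      · rintro ⟨h, h'⟩
        refine ⟨by simpa [Instr.apply, State.setReg, e13] using h, fun k hk => ?_⟩
        rcases Nat.lt_succ_iff_lt_or_eq.1 hk with hk | rfl
        exacts [h' k hk, h0]
      · rintro ⟨h, h', p, hp, hp'⟩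
        exact ⟨by simpa [Instr.apply, State.setReg, e13] using h,
          by simpa [Instr.apply, State.setReg, e3] using h', p, by omega, hp'⟩
    · have h1 : f (V j) = 1 := (ZMod.two_eq_zero_or_one _).resolve_left (by
        simpa [Test.Holds, h12] using hb)
      -- `w` is the pivot from now on: `V j` if none was found before, and otherwise the old `u`.
      -- Either choice describes the earlier rows equally well.
      obtain ⟨w, hw, hw', hwu⟩ : ∃ w : ℕ → ZMod 2,
          (s₂.reg 13 = 0 ∧ w = V j ∨ s₂.reg 13 ≠ 0 ∧ ∀ c < n + 1, s₂.arr 3 c = (w c).val) ∧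
          (∃ p < j + 1, f (V p) = 1 ∧ (∀ k < p, f (V k) = 0) ∧ w = V p) ∧
          ∀ k < j, f (V k) • w = f (V k) • u := by
        rw [e13, e3]
        rcases hu with ⟨h, h'⟩ | ⟨h, h', p, hp, hp'⟩
        · exact ⟨V j, .inl ⟨h, rfl⟩, ⟨j, by omega, h1, h', rfl⟩, fun k hk => by simp [h' k hk]⟩
        · exact ⟨u, .inr ⟨h, h'⟩, ⟨p, by omega, hp'⟩, fun _ _ => rfl⟩
      refine .seq (T := (n + 1) * 10 + 2) (T' := 1) ((addSaved_ensures ((hfr₂.reg 3 rfl).trans h3) e9 (v := V j)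
        (by rwa [e2]) hw).mono le_rfl ?_)
      rintro s₃ - ⟨g9, g3, g2, g2'⟩ hfr₃
      refine .instr (T := 0) _ ⟨?_, ?_, w, ?_, .inr ⟨?_, ?_, hw'⟩⟩
      · have := (hfr₃.reg 8 rfl).trans h8'
        simpa [Instr.apply, State.setReg, Nat.succ_mul] using this
      · simpa [Instr.apply, State.setReg, Nat.succ_mul] using g9
      · simp only [Instr.apply, State.setReg]
        refine hR.update (j := j) (fun l hl => by rw [g2' l hl, e2]) (fun c hc => ?_)
          fun k hk hkj => ?_
        · rw [g2 c hc]
          simp [h1]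
        · by_cases hkj' : k < j
          · simp only [hkj', if_true, if_pos (Nat.lt_succ_of_lt hkj'), hwu k hkj']
          · simp only [if_neg hkj', if_neg (show ¬ k < j + 1 by omega)]
      · simp [Instr.apply, State.setReg]
      · simpa [Instr.apply, State.setReg] using g3
  · ring_nf
    rfl
  · rintro s' - ⟨-, -, u, hR, ⟨-, h0⟩ | ⟨-, -, p, hp, hp1, hlt, rfl⟩⟩
    · exact ⟨V, hR.congr fun k hk => by simp [hk, h0 k hk], hS.inf_ker_of_forall f h0⟩
    · exact ⟨_, hR, hS.inf_ker f hp hp1 hlt fun k hk => by simp only [if_pos hk]⟩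

theorem identity_ensures {s : State} {N : ℕ} (hN : s.reg 3 = N) :
    Ensures identity s (N * (N * 7 + 4) + 3) fun s' =>
      RowsAt (s'.arr 2) N N fun j c => if j = c then 1 else 0 := by
  refine .instr_seq _ (Ensures.mono (Ensures.forLoop (fun j s' => s'.reg 8 = j * N ∧
    RowsAt (s'.arr 2) j N fun j c => if j = c then 1 else 0) N (N * 7 + 2) hN ?_ ?_ ?_)
      le_rfl fun s' _ h => h.2)
  · exact ⟨by simp [Instr.apply, State.setReg], fun j hj => by omega⟩
  · exact fun _ _ _ h => h
  · rintro j hj s₁ hij hfr ⟨h8, hR⟩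
    refine (Ensures.forLoop (fun c s' => s'.reg 8 = j * N + c ∧
      (∀ l < j * N, s'.arr 2 l = s₁.arr 2 l) ∧
      ∀ k < c, s'.arr 2 (j * N + k) = if j = k then 1 else 0) N 5
        ((hfr.reg 3 rfl).trans hN) ?_ ?_ ?_).mono le_rfl ?_
    · simp [h8]
    · exact fun _ _ _ h => h
    · rintro c hc s₂ hic hfr₂ ⟨h1, h2, h3⟩
      have e5 : s₂.reg 5 = j := (hfr₂.reg 5 rfl).trans hij
      refine .instr_seq _ (.seq (T := 2) (T' := 2) (.mono (T := 2) (Q := fun s' =>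
        s'.reg 10 = if j = c then 1 else 0) (.cond (fun hb => .instr _ ?_)
          fun hb => .skip ?_) le_rfl ?_))
      · simp [Test.Holds, Instr.apply, State.setReg, hic, e5] at hb
        simp [Instr.apply, State.setReg, hb]
      · simp [Test.Holds, Instr.apply, State.setReg, hic, e5] at hb
        simp [Instr.apply, State.setReg, hb]
      · intro s₃ hfr₃ h10 _
        have e8 : s₃.reg 8 = j * N + c := (hfr₃.reg 8 rfl).trans h1
        have e2 : s₃.arr 2 = s₂.arr 2 := hfr₃.arr 2 rfl
        refine .instr_seq _ (.instr _ ⟨?_, fun l hl => ?_, fun k hk => ?_⟩)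
        · simp [Instr.apply, State.setReg, State.setArr, e8, add_assoc]
        · simp only [Instr.apply, State.setReg, State.setArr]
          simp [e8, e2, Function.update_apply]
          rw [if_neg (by omega)]
          exact h2 l hl
        · simp only [Instr.apply, State.setReg, State.setArr]
          simp only [e8, e2, h10, Function.update_self, Function.update_apply, add_right_inj]
          by_cases hkc : k = c
          · rw [if_pos hkc, hkc]
          · rw [if_neg hkc, h3 k (by omega)]
    · rintro s₂ - ⟨h1, h2, h3⟩
      refine ⟨by rw [h1, Nat.succ_mul], hR.append h2 fun c hc => ?_⟩
      rw [h3 c hc]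
      split_ifs <;> rfl

theorem eliminate_ensures {s : State} (φ : AffineFormula) (h0 : s.reg 0 = φ.numVars)
    (h1 : s.reg 1 = φ.numEqs) (h3 : s.reg 3 = φ.numVars + 1)
    (hA : ∀ i < φ.numEqs, ∀ c < φ.numVars, s.arr 0 (i * φ.numVars + c) = (φ.row i c).val)
    (hb : ∀ i < φ.numEqs, s.arr 1 i = (φ.row i φ.numVars).val)
    (hV : RowsAt (s.arr 2) (φ.numVars + 1) (φ.numVars + 1) fun j c => if j = c then 1 else 0) :
    Ensures eliminate s (φ.numEqs * (φ.numVars * 5 +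
        ((φ.numVars + 1) * ((φ.numVars + 1) * 18 + 9) + 11)) + 3) fun s' =>
      ∃ V, RowsAt (s'.arr 2) (φ.numVars + 1) (φ.numVars + 1) V ∧
        SystematicSpan φ.numVars φ.homSolutions V := by
  set n := φ.numVars with hn
  refine .instr_seq _ (Ensures.mono (Ensures.forLoop (fun i s' => s'.reg 7 = i * n ∧
    ∃ V, RowsAt (s'.arr 2) (n + 1) (n + 1) V ∧ SystematicSpan n (solutions (n + 1) φ.row i) V)
    φ.numEqs ((n * 5 + 2) + (((n + 1) * ((n + 1) * 18 + 9) + 5) + 1 + 1)) h1 ?_ ?_ ?_) ?_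
      fun s' _ h => h.2)
  · exact ⟨by simp [Instr.apply, State.setReg], _, hV, systematicSpan_one n φ.row⟩
  · exact fun _ _ _ h => h
  · rintro i hi s₁ hii hfr ⟨h7, V, hR, hS⟩
    -- Only the `n` coefficients are copied; the right-hand side is then stored in cell `n` of array
    -- 5.
    refine .seq ((copyRow_ensures n ((hfr.reg 0 rfl).trans h0)).mono le_rfl ?_)
    rintro s₂ - ⟨g7, g5⟩ hfr₂
    have e0 : s₁.arr 0 = s.arr 0 := hfr.arr 0 rfl
    have e1 : s₂.arr 1 = s.arr 1 := (hfr₂.arr 1 rfl).trans (hfr.arr 1 rfl)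
    have e2 : s₂.arr 2 = s₁.arr 2 := hfr₂.arr 2 rfl
    have e4 : s₂.reg 4 = i := (hfr₂.reg 4 rfl).trans hii
    have r0 : s₂.reg 0 = n := (hfr₂.reg 0 rfl).trans ((hfr.reg 0 rfl).trans h0)
    have r3 : s₂.reg 3 = n + 1 := (hfr₂.reg 3 rfl).trans ((hfr.reg 3 rfl).trans h3)
    refine .instr_seq _ (.instr_seq _ ((pivotStep_ensures (n := n) (a := φ.row i) (V := V)
      (S := solutions (n + 1) φ.row i) ?_ ?_ ?_ hS).mono le_rfl ?_))
    · simp [Instr.apply, State.setReg, State.setArr, r3]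
    · intro c hc
      simp only [Instr.apply, State.setReg, State.setArr]
      simp [r0, e1, e4, Function.update_apply]
      split_ifs with hcn
      · rw [hcn, hb i hi]
      · rw [g5 c (by omega), h7, e0, hA i hi c (by omega)]
    · simpa [Instr.apply, State.setReg, State.setArr, e2] using hR
    · rintro s₃ hfr₃ ⟨V', hR', hS'⟩
      refine ⟨?_, V', hR', hS'⟩
      rw [hfr₃.reg 7 rfl]
      simp [Instr.apply, State.setReg, State.setArr, g7, h7, Nat.succ_mul]
  · apply le_of_eq
    ring

/-! ### Listing and scanning the linear combinations -/

theorem appendSums_ensures {s : State} {M N : ℕ} {L : ℕ → ℕ → ZMod 2} {v : ℕ → ZMod 2}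
    (hN : s.reg 3 = N) (hpos : 0 < N) (he : s.reg 15 = M * N) (hL : RowsAt (s.arr 4) M N L)
    (hv : ∀ c < N, s.arr 5 c = (v c).val) :
    Ensures appendSums s (M * (N * 9 + 3) + 4) fun s' => s'.reg 15 = (M + M) * N ∧
      RowsAt (s'.arr 4) (M + M) N fun q => if q < M then L q else L (q - M) + v := by
  set L' : ℕ → ℕ → ZMod 2 := fun q => if q < M then L q else L (q - M) + v with hL'
  have hadd : ∀ k, L' (M + k) = L k + v := fun k => by simp [hL']
  refine .instr_seq _ (.instr_seq _ (.seq (T := M * (N * 9 + 2 + 1) + 1) (T' := 1)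
    ((Ensures.loop (fun k s' => s'.reg 14 = k * N ∧ s'.reg 9 = (M + k) * N ∧
      RowsAt (s'.arr 4) (M + k) N L') M (N * 9 + 2) ?_ ?_ ?_).mono le_rfl ?_)))
  · refine ⟨?_, ?_, ?_⟩
    · simp [Instr.apply, State.setReg]
    · simp [Instr.apply, State.setReg, he]
    · exact RowsAt.congr (f := s.arr 4) hL fun j hj => (if_pos hj).symm
  · rintro k hk s₁ hfr ⟨h14, h9, hR⟩
    have e15 : s₁.reg 15 = M * N := (hfr.reg 15 rfl).trans he
    have e3 : s₁.reg 3 = N := (hfr.reg 3 rfl).trans hN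
    have e5 : s₁.arr 5 = s.arr 5 := hfr.arr 5 rfl
    -- Register 15 keeps the old end of the list during the loop, so appended rows are not read
    -- again. Comparing positions instead of row numbers requires `0 < N`.
    refine ⟨by simpa [Test.Holds, h14, e15] using add_mul_lt_mul hk hpos, ?_⟩
    refine (Ensures.forLoop (fun c s' => s'.reg 14 = k * N + c ∧ s'.reg 9 = (M + k) * N + c ∧
      (∀ l < (M + k) * N, s'.arr 4 l = s₁.arr 4 l) ∧
      ∀ b < c, s'.arr 4 ((M + k) * N + b) = (L' (M + k) b).val) N 7 e3 ?_ ?_ ?_).mono le_rfl ?_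
    · simp [h14, h9]
    · exact fun _ _ _ h => h
    · rintro c hc s₂ hic hfr₂ ⟨g14, g9, g4, g4'⟩
      have f5 : s₂.arr 5 = s.arr 5 := (hfr₂.arr 5 rfl).trans e5
      have hLk : s₂.arr 4 (k * N + c) = (L k c).val := by
        rw [g4 _ (add_mul_lt_mul (by omega) hc), hR k (by omega) c hc]
        simp [hL', hk]
      refine .instr_seq _ (.instr_seq _ (.seq (T := 2) (T' := 3)
        (xorInto_ensures (L k c) (v c) ?_ ?_ fun _ =>
          .instr_seq _ (.instr_seq _ (.instr _ ⟨?_, ?_, fun l hl => ?_, fun b hb => ?_⟩)))))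
      · simp [Instr.apply, State.setReg, g14, hLk]
      · simp [Instr.apply, State.setReg, f5, hic, hv c hc]
      · simp [Instr.apply, State.setReg, State.setArr, g14, add_assoc]
      · simp [Instr.apply, State.setReg, State.setArr, g9, add_assoc]
      · simp only [Instr.apply, State.setReg, State.setArr]
        simp [g9, Function.update_apply]
        rw [if_neg (by omega)]
        exact g4 l hl
      · simp only [Instr.apply, State.setReg, State.setArr]
        simp [g9, Function.update_apply]
        split_ifs with hbc
        · rw [hbc, hadd, Pi.add_apply]
        · exact g4' b (by omega)
    · rintro s₂ - ⟨g14, g9, g4, g4'⟩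
      exact ⟨by rw [g14, Nat.succ_mul], by rw [g9, ← add_assoc, Nat.succ_mul],
        hR.append g4 g4'⟩
  · rintro s₁ hfr ⟨h14, -, -⟩
    have e15 : s₁.reg 15 = M * N := (hfr.reg 15 rfl).trans he
    simp [Test.Holds, h14, e15]
  · rintro s₁ - ⟨-, h9, hR⟩ -
    exact .instr _ ⟨by simp [Instr.apply, State.setReg, h9], hR⟩

open Classical in
theorem scan_ensures {s : State} {M N d : ℕ} {L : ℕ → ℕ → ZMod 2}
    (hN : s.reg 3 = N) (hpos : 0 < N) (hd : s.reg 2 = d) (he : s.reg 15 = M * N)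
    (hL : RowsAt (s.arr 4) M N L) :
    Ensures scan s (M * (N * 6 + 6) + 3) fun s' =>
      s'.reg 17 = if ∃ q < M, d ≤ weight N (L q) then 1 else 0 := by
  refine .instr_seq _ (.instr_seq _ (Ensures.mono (Ensures.loop (fun k s' => s'.reg 14 = k * N ∧
    s'.reg 17 = if ∃ q < k, d ≤ weight N (L q) then 1 else 0) M (((N * 6 + 2) + 2) + 1)
      ?_ ?_ ?_) le_rfl fun s' _ h => h.2))
  · simp [Instr.apply, State.setReg]
  · rintro k hk s₁ hfr ⟨h14, h17⟩
    have e15 : s₁.reg 15 = M * N := (hfr.reg 15 rfl).trans he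
    have e3 : s₁.reg 3 = N := (hfr.reg 3 rfl).trans hN
    have e2 : s₁.reg 2 = d := (hfr.reg 2 rfl).trans hd
    have e4 : s₁.arr 4 = s.arr 4 := hfr.arr 4 rfl
    refine ⟨by simpa [Test.Holds, h14, e15] using add_mul_lt_mul hk hpos, ?_⟩
    refine .instr_seq _ (.seq (T := N * 6 + 2) (T' := 2) (Ensures.mono (Ensures.forLoop (fun c s' =>
      s'.reg 14 = k * N + c ∧ s'.reg 12 = weight c (L k)) N 4 ?_ ?_ ?_ ?_) le_rfl ?_))
    · simpa [Instr.apply, State.setReg] using e3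
    · simp [Instr.apply, State.setReg, h14, weight]
    · exact fun _ _ _ h => h
    · rintro c hc s₂ hic hfr₂ ⟨g14, g12⟩
      have f4 : s₂.arr 4 = s.arr 4 := (hfr₂.arr 4 rfl).trans e4
      refine .instr_seq _ (.instr_seq _ (.cond (fun hb => .skip ?_) fun hb => .instr _ ?_))
      · simp [Test.Holds, Instr.apply, State.setReg, g14, f4, hL k hk c hc] at hb
        simp [Instr.apply, State.setReg, g14, g12, add_assoc, weight, Finset.range_add_one,
          Finset.filter_insert, hb]
      · simp [Test.Holds, Instr.apply, State.setReg, g14, f4, hL k hk c hc] at hb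
        simp [Instr.apply, State.setReg, g14, g12, add_assoc, weight, Finset.range_add_one,
          Finset.filter_insert, hb]
    · rintro s₂ hfr₂ ⟨g14, g12⟩ -
      have f2 : s₂.reg 2 = d := (hfr₂.reg 2 rfl).trans e2
      have f17 : s₂.reg 17 = _ := (hfr₂.reg 17 rfl).trans h17
      have hex : (∃ q < k + 1, d ≤ weight N (L q)) ↔
          (∃ q < k, d ≤ weight N (L q)) ∨ d ≤ weight N (L k) := by
        constructor
        · rintro ⟨q, hq, h⟩
          rcases Nat.lt_succ_iff_lt_or_eq.1 hq with hq | rfl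
          exacts [.inl ⟨q, hq, h⟩, .inr h]
        · rintro (⟨q, hq, h⟩ | h)
          exacts [⟨q, by omega, h⟩, ⟨k, by omega, h⟩]
      simp only [hex]
      refine .cond (T := 1) (fun hb => .skip ⟨?_, ?_⟩) fun hb => .instr _ ⟨?_, ?_⟩
      · rw [g14, Nat.succ_mul]
      · simp only [Test.Holds, g12, f2] at hb
        simp only [f17, not_le.2 hb, or_false]
      · simp [Instr.apply, State.setReg, g14, Nat.succ_mul]
      · simp only [Test.Holds, g12, f2, not_lt] at hb
        simp [Instr.apply, State.setReg, hb]
  · rintro s₁ hfr ⟨h14, -⟩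
    have e15 : s₁.reg 15 = M * N := (hfr.reg 15 rfl).trans he
    simp [Test.Holds, h14, e15]

/-- The coefficient of `v` is 0 or 1; this is the doubling performed by `appendSums`. -/
theorem mem_span_insert_iff {v x : ℕ → ZMod 2} {A : Set (ℕ → ZMod 2)} :
    x ∈ Submodule.span (ZMod 2) (insert v A) ↔
      x ∈ Submodule.span (ZMod 2) A ∨ ∃ y ∈ Submodule.span (ZMod 2) A, y + v = x := by
  rw [Submodule.mem_span_insert]
  constructor
  · rintro ⟨c, y, hy, rfl⟩
    rcases ZMod.two_eq_zero_or_one c with rfl | rfl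
    · left
      simpa using hy
    · exact .inr ⟨y, hy, by rw [one_smul, add_comm]⟩
  · rintro (hx | ⟨y, hy, rfl⟩)
    · exact ⟨0, x, hx, by simp⟩
    · exact ⟨1, y, hy, by rw [one_smul, add_comm]⟩

/-- `I` collects the selected indices and register 16 holds `d - I.card`. Selection stops only when
that budget is used up, so either `d` rows are selected or none with nonzero diagonal entry is
missed. Each selection doubles the list, which never exceeds `2 ^ d` rows. -/
theorem enumerate_ensures {s : State} {n d : ℕ} {V : ℕ → ℕ → ZMod 2} (h0 : s.reg 0 = n)
    (h2 : s.reg 2 = d) (h3 : s.reg 3 = n + 1) (h4 : s.arr 4 = fun _ => 0)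
    (hV : RowsAt (s.arr 2) (n + 1) (n + 1) V) :
    Ensures enumerate s (n * ((n + 1) * 5 + 2 ^ d * ((n + 1) * 9 + 3) + 12) + 5) fun s' =>
      s'.reg 8 = n * (n + 1) ∧ ∃ (I : Finset ℕ) (L : ℕ → ℕ → ZMod 2), I.card ≤ d ∧
        (∀ j ∈ I, j < n ∧ V j j ≠ 0) ∧ (I.card = d ∨ ∀ j < n, V j j ≠ 0 → j ∈ I) ∧
        (∀ x, x ∈ Submodule.span (ZMod 2) (V '' I) ↔ ∃ q < 2 ^ I.card, L q = x) ∧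
        s'.reg 15 = 2 ^ I.card * (n + 1) ∧ RowsAt (s'.arr 4) (2 ^ I.card) (n + 1) L := by
  refine .instr_seq _ (.instr_seq _ (.instr_seq _ (Ensures.mono (Ensures.forLoop (fun i s' =>
    s'.reg 8 = i * (n + 1) ∧ ∃ (I : Finset ℕ) (L : ℕ → ℕ → ZMod 2), s'.reg 16 + I.card = d ∧
        (∀ j ∈ I, j < i ∧ V j j ≠ 0) ∧ (s'.reg 16 = 0 ∨ ∀ j < i, V j j ≠ 0 → j ∈ I) ∧
        (∀ x, x ∈ Submodule.span (ZMod 2) (V '' I) ↔ ∃ q < 2 ^ I.card, L q = x) ∧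
        s'.reg 15 = 2 ^ I.card * (n + 1) ∧ RowsAt (s'.arr 4) (2 ^ I.card) (n + 1) L)
    n (((n + 1) * 5 + 2) + ((2 ^ d * ((n + 1) * 9 + 3) + 4) + 1 + 1 + 1 + 1)) h0 ?_ ?_ ?_) ?_ ?_)))
  -- The list starts with the zero vector, already present because array 4 is initially 0.
  · refine ⟨?_, ∅, 0, ?_, ?_, ?_, ?_, ?_, ?_⟩
    · simp [Instr.apply, State.setReg]
    · simp [Instr.apply, State.setReg, h2]
    · simp
    · simp
    · simp [eq_comm]
    · simp [Instr.apply, State.setReg, h3]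
    · intro j hj c hc
      simp [Instr.apply, State.setReg, h4]
  · exact fun _ _ _ h => h
  · rintro i hi s₁ hii hfr ⟨h8, I, L, hcard, hI, hI', hsp, h15, hL⟩
    have e3 : s₁.reg 3 = n + 1 := (hfr.reg 3 rfl).trans h3
    have e2 : s₁.arr 2 = s.arr 2 := hfr.arr 2 rfl
    refine .seq ((copyRow_ensures (n + 1) e3).mono le_rfl ?_)
    rintro s₂ - ⟨g8, g5⟩ hfr₂
    have g5 : ∀ c < n + 1, s₂.arr 5 c = (V i c).val := fun c hc => by
      rw [g5 c hc, h8, e2, hV i (by omega) c hc]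
    have g8 : s₂.reg 8 = (i + 1) * (n + 1) := by rw [g8, h8, Nat.succ_mul]
    have f5 : s₂.reg 5 = i := (hfr₂.reg 5 rfl).trans hii
    have f3 : s₂.reg 3 = n + 1 := (hfr₂.reg 3 rfl).trans e3
    have f15 : s₂.reg 15 = 2 ^ I.card * (n + 1) := (hfr₂.reg 15 rfl).trans h15
    have f16 : s₂.reg 16 = s₁.reg 16 := hfr₂.reg 16 rfl
    have f4 : s₂.arr 4 = s₁.arr 4 := hfr₂.arr 4 rfl
    rw [← f16] at hcard hI'
    rw [← f4] at hL
    have hI₁ : ∀ j ∈ I, j < i + 1 ∧ V j j ≠ 0 := fun j hj =>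
      ⟨Nat.lt_succ_of_lt (hI j hj).1, (hI j hj).2⟩
    refine .instr_seq _ (.cond (fun hb => .skip ⟨?_, I, L, hcard, hI₁, hI'.imp_right ?_, hsp, f15,
      hL⟩) fun hb => .cond (fun hb' => .skip ⟨?_, I, L, hcard, hI₁, .inl hb', hsp, f15, hL⟩)
        fun hb' => ?_)
    · simpa [Instr.apply, State.setReg] using g8
    · simp [Test.Holds, Instr.apply, State.setReg, f5, g5 i (by omega)] at hb
      intro h j hj hj0
      rcases Nat.lt_succ_iff_lt_or_eq.1 hj with hj | rfl
      exacts [h j hj hj0, (hj0 hb).elim]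
    · simpa [Instr.apply, State.setReg] using g8
    · have hi0 : V i i ≠ 0 := by
        simpa [Test.Holds, Instr.apply, State.setReg, f5, g5 i (by omega)] using hb
      have h16 : s₂.reg 16 ≠ 0 := by
        simpa [Test.Holds, Instr.apply, State.setReg] using hb'
      have hiI : i ∉ I := fun h => lt_irrefl _ (hI i h).1
      have hpow : 2 ^ I.card ≤ 2 ^ d := Nat.pow_le_pow_right (by norm_num) (by omega)
      have hcard' : (insert i I).card = I.card + 1 := Finset.card_insert_of_notMem hiI
      refine .instr_seq _ ((appendSums_ensures (M := 2 ^ I.card) (N := n + 1) (L := L)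
        (v := V i) ?_ (by omega) ?_ ?_ ?_).mono
          (by have := Nat.mul_le_mul_right ((n + 1) * 9 + 3) hpow; omega) ?_)
      · simpa [Instr.apply, State.setReg] using f3
      · simpa [Instr.apply, State.setReg] using f15
      · simpa [Instr.apply, State.setReg] using hL
      · simpa [Instr.apply, State.setReg] using g5
      · rintro s₃ hfr₃ ⟨k15, hL'⟩
        have k16 : s₃.reg 16 = s₂.reg 16 - 1 := (hfr₃.reg 16 rfl).trans (by
          simp [Instr.apply, State.setReg])
        have k8 : s₃.reg 8 = (i + 1) * (n + 1) := (hfr₃.reg 8 rfl).trans (by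
          simpa [Instr.apply, State.setReg] using g8)
        rw [← two_mul, ← pow_succ', ← hcard'] at k15 hL'
        refine ⟨k8, insert i I, _, ?_, ?_, ?_, ?_, k15, hL'⟩
        · omega
        · intro j hj
          rcases Finset.mem_insert.1 hj with rfl | hj
          exacts [⟨by omega, hi0⟩, hI₁ j hj]
        · right
          intro j hj hj0
          rcases Nat.lt_succ_iff_lt_or_eq.1 hj with hj | rfl
          · exact Finset.mem_insert_of_mem (hI'.resolve_left h16 j hj hj0)
          · exact Finset.mem_insert_self _ _
        · intro x
          rw [Finset.coe_insert, Set.image_insert_eq, mem_span_insert_iff, hcard', pow_succ']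
          simp only [hsp]
          constructor
          · rintro (⟨q, hq, rfl⟩ | ⟨_, ⟨q, hq, rfl⟩, rfl⟩)
            · exact ⟨q, by omega, by rw [if_pos hq]⟩
            · exact ⟨q + 2 ^ I.card, by omega, by simp⟩
          · rintro ⟨q, hq, rfl⟩
            by_cases hq' : q < 2 ^ I.card
            · exact .inl ⟨q, hq', by rw [if_pos hq']⟩
            · exact .inr ⟨_, ⟨q - 2 ^ I.card, by omega, rfl⟩, by rw [if_neg hq']⟩
  · apply le_of_eq
    ring
  · rintro s' - ⟨h8, I, L, hcard, hI, hI', h⟩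
    exact ⟨h8, I, L, by omega, hI, hI'.imp_left (by omega), h⟩

/-- If `d` vectors are selected, their sum already has weight at least `d`; otherwise all the
nonzero vectors are selected and nothing is lost from the span. -/
theorem exists_weight_iff {n d : ℕ} {S : Submodule (ZMod 2) (ℕ → ZMod 2)}
    {V : ℕ → ℕ → ZMod 2} (hV : SystematicSpan n S V) {I : Finset ℕ}
    (hI : ∀ j ∈ I, j < n ∧ V j j ≠ 0) (hI' : I.card = d ∨ ∀ j < n, V j j ≠ 0 → j ∈ I) :
    (∃ x ∈ Submodule.span (ZMod 2) (V '' Set.Iio n), d ≤ weight (n + 1) x) ↔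
      ∃ x ∈ Submodule.span (ZMod 2) (V '' I), d ≤ weight (n + 1) x := by
  refine ⟨?_, fun ⟨x, hx, h⟩ => ⟨x, Submodule.span_mono (Set.image_mono fun j hj =>
    (hI j hj).1) hx, h⟩⟩
  rintro ⟨x, hx, h⟩
  rcases hI' with rfl | hI'
  · exact ⟨∑ j ∈ I, V j, Submodule.sum_mem _ fun j hj => Submodule.subset_span ⟨j, hj, rfl⟩,
      hV.card_le_weight I hI⟩
  · refine ⟨x, Submodule.span_le.2 ?_ hx, h⟩
    rintro _ ⟨j, hj, rfl⟩
    have hjn : j < n := hj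
    by_cases h0 : V j j = 0
    · rw [hV.eq_zero j (by omega) h0]
      exact Submodule.zero_mem _
    · exact Submodule.subset_span ⟨j, hI' j hjn h0, rfl⟩

/-! ### Assembling the program and bounding its running time -/

theorem input_coeff (φ : AffineFormula) (d : ℕ) {i c : ℕ} (hi : i < φ.numEqs)
    (hc : c < φ.numVars) :
    (input φ d).arr 0 (i * φ.numVars + c) = (φ.row i c).val := by
  have h : i * φ.numVars + c < φ.numEqs * φ.numVars := add_mul_lt_mul hi hc
  have hfin : (⟨i * φ.numVars + c, h⟩ : Fin (φ.numEqs * φ.numVars)) =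
      finProdFinEquiv (⟨i, hi⟩, ⟨c, hc⟩) := by
    ext
    simp [add_comm, mul_comm]
  simp only [input, dif_pos h]
  rw [hfin, Equiv.symm_apply_apply]
  simp [AffineFormula.row, hi, hc]

theorem input_rhs (φ : AffineFormula) (d : ℕ) {i : ℕ} (hi : i < φ.numEqs) :
    (input φ d).arr 1 i = (φ.row i φ.numVars).val := by
  simp [input, AffineFormula.row, hi]

open Classical in
theorem maxDiffer_ensures (φ : AffineFormula) (d : ℕ) :
    Ensures maxDiffer (input φ d)
      ((φ.numVars + 1) * ((φ.numVars + 1) * 7 + 4) + 3 +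
        (φ.numEqs * (φ.numVars * 5 +
          ((φ.numVars + 1) * ((φ.numVars + 1) * 18 + 9) + 11)) + 3 +
        (φ.numVars * ((φ.numVars + 1) * 5 + 2 ^ d * ((φ.numVars + 1) * 9 + 3) + 12) + 5 +
        ((φ.numVars + 1) * 5 + 2 +
        (2 ^ d * ((φ.numVars + 1) * 6 + 6) + 3 + 1 + 1 + 1)))) + 1 + 1)
      fun s' => s'.reg 0 = if φ.MaxDiffer d then 1 else 0 := by
  set n := φ.numVars with hn
  refine .instr_seq _ (.instr_seq _ ?_)
  set s₀ := Instr.apply (Instr.apply (input φ d) (.copy 3 0)) (.succ 3) with hs₀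
  have a0 : s₀.reg 0 = n := rfl
  have a1 : s₀.reg 1 = φ.numEqs := rfl
  have a2 : s₀.reg 2 = d := rfl
  have a3 : s₀.reg 3 = n + 1 := rfl
  have a4 : s₀.arr = (input φ d).arr := rfl
  refine .seq ((identity_ensures a3).mono le_rfl ?_)
  rintro s₁ hf₁ hid -
  have b4 : s₁.arr 4 = fun _ => 0 := hf₁.arr 4 rfl
  refine .seq ((eliminate_ensures φ ((hf₁.reg 0 rfl).trans a0) ((hf₁.reg 1 rfl).trans a1)
    ((hf₁.reg 3 rfl).trans a3) (fun i hi c hc => ?_) (fun i hi => ?_) hid).mono le_rfl ?_)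
  · rw [hf₁.arr 0 rfl, a4, input_coeff φ d hi hc]
  · rw [hf₁.arr 1 rfl, a4, input_rhs φ d hi]
  rintro s₂ hf₂ ⟨V, hV, hS⟩ -
  have c0 : s₂.reg 0 = n := (hf₂.reg 0 rfl).trans ((hf₁.reg 0 rfl).trans a0)
  have c2 : s₂.reg 2 = d := (hf₂.reg 2 rfl).trans ((hf₁.reg 2 rfl).trans a2)
  have c3 : s₂.reg 3 = n + 1 := (hf₂.reg 3 rfl).trans ((hf₁.reg 3 rfl).trans a3)
  refine .seq ((enumerate_ensures c0 c2 c3 ((hf₂.arr 4 rfl).trans b4) hV).mono le_rfl ?_)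
  rintro s₃ hf₃ ⟨d8, I, L, hcard, hI, hI', hsp, d15, hL⟩ -
  have d2 : s₃.reg 2 = d := (hf₃.reg 2 rfl).trans c2
  have d3 : s₃.reg 3 = n + 1 := (hf₃.reg 3 rfl).trans c3
  refine .seq ((copyRow_ensures (n + 1) d3).mono le_rfl ?_)
  rintro s₄ hf₄ ⟨-, e5⟩ -
  have e0 : s₄.reg 0 = n := (hf₄.reg 0 rfl).trans ((hf₃.reg 0 rfl).trans c0)
  -- `enumerate` leaves register 8 at the start of row `n`, so the row copied next is `V n`.
  have e5n : s₄.arr 5 n = (V n n).val := by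
    rw [e5 n (by omega), d8, hf₃.arr 2 rfl, hV n (by omega) n (by omega)]
  have hiff := φ.maxDiffer_iff d hS
  rw [exists_weight_iff hS hI hI'] at hiff
  refine .instr_seq _ (.cond (fun hb => .instr _ ?_) fun hb => ?_)
  · have h0 : V n n = 0 := by
      simpa [Test.Holds, Instr.apply, State.setReg, e0, e5n] using hb
    have hno : ¬ φ.MaxDiffer d := fun h => (hiff.1 h).1 h0
    simp [Instr.apply, State.setReg, hno]
  · have h0 : V n n ≠ 0 := by
      simpa [Test.Holds, Instr.apply, State.setReg, e0, e5n] using hb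
    have hiff' : φ.MaxDiffer d ↔ ∃ q < 2 ^ I.card, d ≤ weight (n + 1) (L q) := by
      rw [hiff, and_iff_right h0]
      constructor
      · rintro ⟨x, hx, h⟩
        obtain ⟨q, hq, rfl⟩ := (hsp x).1 hx
        exact ⟨q, hq, h⟩
      · rintro ⟨q, hq, h⟩
        exact ⟨_, (hsp _).2 ⟨q, hq, rfl⟩, h⟩
    have hpow : 2 ^ I.card ≤ 2 ^ d := Nat.pow_le_pow_right (by norm_num) hcard
    have hT : 2 ^ I.card * ((n + 1) * 6 + 6) + 3 ≤ 2 ^ d * ((n + 1) * 6 + 6) + 3 := by gcongr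
    refine .seq (T := 2 ^ d * ((n + 1) * 6 + 6) + 3) (T' := 1) (((scan_ensures (M := 2 ^ I.card) (N := n + 1) (d := d) (L := L) ?_ (by omega)
      ?_ ?_ ?_)).mono hT ?_)
    · exact (hf₄.reg 3 rfl).trans d3
    · exact (hf₄.reg 2 rfl).trans d2
    · exact (hf₄.reg 15 rfl).trans d15
    · have f4 : s₄.arr 4 = s₃.arr 4 := hf₄.arr 4 rfl
      rw [← f4] at hL
      exact hL
    · rintro s₅ - h17 -
      refine .instr (T := 0) _ ?_
      simp only [hiff']
      simpa [Instr.apply, State.setReg] using h17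

end RAM

theorem mainTheorem3 :
    ∃ (P : RAM.Program) (p : Polynomial ℕ),
      RAM.DecidesInTime P AffineFormula.MaxDiffer (fun φ d => 2 ^ d * p.eval φ.size) := by
  refine ⟨RAM.Program.maxDiffer, 300 * (Polynomial.X + 1) ^ 3, fun φ d => ?_⟩
  obtain ⟨s, t, hr, ht, hs⟩ := RAM.maxDiffer_ensures φ d
  refine ⟨s, t, hr, ht.trans ?_, ?_⟩
  · have heval : (300 * (Polynomial.X + 1) ^ 3 : Polynomial ℕ).eval φ.size =
        300 * (φ.size + 1) ^ 3 := by simp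
    dsimp only
    rw [heval]
    obtain ⟨x, hx⟩ : ∃ x, x = φ.size + 1 := ⟨_, rfl⟩
    have hN : φ.numVars + 1 ≤ x := by rw [hx, AffineFormula.size]; omega
    have hn : φ.numVars ≤ x := by omega
    have hm : φ.numEqs ≤ x := by rw [hx, AffineFormula.size]; omega
    have h1 : 1 ≤ x := by omega
    rw [← hx]
    have hD : 1 ≤ 2 ^ d := Nat.one_le_two_pow
    generalize 2 ^ d = D at hD ⊢
    -- Every monomial of the bound is at most `x ^ 3 * D`, and the coefficients sum to less than
    -- 300. The cubic term comes from elimination; the terms with `D` are at most quadratic in `x`.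
    have h3 : ∀ k ≤ 3, ∀ b ≤ D, x ^ k * b ≤ x ^ 3 * D := fun k hk b hb =>
      Nat.mul_le_mul (Nat.pow_le_pow_right h1 hk) hb
    have k01 := h3 0 (by norm_num) 1 hD
    have k11 := h3 1 (by norm_num) 1 hD
    have k21 := h3 2 (by norm_num) 1 hD
    have k31 := h3 3 le_rfl 1 hD
    have k0D := h3 0 (by norm_num) D le_rfl
    have k1D := h3 1 (by norm_num) D le_rfl
    have k2D := h3 2 (by norm_num) D le_rfl
    calc _ ≤ x * (x * 7 + 4) + 3 + (x * (x * 5 + (x * (x * 18 + 9) + 11)) + 3 +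
          (x * (x * 5 + D * (x * 9 + 3) + 12) + 5 + (x * 5 + 2 +
          (D * (x * 6 + 6) + 3 + 1 + 1 + 1)))) + 1 + 1 := by gcongr
      _ ≤ D * (300 * x ^ 3) := by linarith
  · by_cases h : φ.MaxDiffer d
    · exact .inl ⟨h, by rw [hs, if_pos h]⟩
    · exact .inr ⟨h, by rw [hs, if_neg h]⟩
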